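/- A function $g:(0,\infty)\to\mathbb R$ is completely monotonic if it is infinitely differentiable and $(-1)^n g^{(n)}(x)\ge 0$ for all $n\ge 0$ and $x>0$. For $\lambda>0$, $\mathcal B_\lambda$ denotes the class of generalized Bernstein functions of order $\lambda$: the $C^\infty$ functions $g:(0,\infty)\to(0,\infty)$ for which $x^{1-\lambda}g'(x)$ is completely monotonic ($\mathcal B_1$ consists of the positive Bernstein functions). For $\alpha\ge 0$, $\mathcal C_\alpha$ denotes the class of functions $f:(0,\infty)\to(0,\infty)$ for which there is a decreasing (not necessarily strictly) and logarithmically convex function $u:(0,\infty)\to(0,\infty)$ such that, for every $x>0$, the integral $\int_0^\infty e^{-xt}u(t)\,dt$ converges and equals $x^\alpha f(x)$. Proposition. Let $\alpha\ge 0$ and $f\in\mathcal C_\alpha$. Then (a) $x^{\alpha+1}f(x)$ belongs to $\mathcal B_1$, i.e. it is a (positive) Bernstein function; (b) $1/f$ belongs to $\mathcal B_{\alpha+1}$; (c) $1/(x^{\alpha+1}f(x))$ is completely monotonic on $(0,\infty)$. -/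

import Mathlib

open Set MeasureTheory
open scoped ContDiff

/-- A real function on `(0, ∞)` (values at other points are irrelevant) is completely monotonic
if it is infinitely often differentiable and `(-1)ⁿ f⁽ⁿ⁾(x) ≥ 0` for all `n ≥ 0` and `x > 0`. -/
def CompletelyMonotonic (f : ℝ → ℝ) : Prop :=
  ContDiffOn ℝ ∞ f (Ioi 0) ∧
    ∀ n : ℕ, ∀ x : ℝ, 0 < x → 0 ≤ (-1 : ℝ) ^ n * iteratedDerivWithin n f (Ioi 0) x

/-- The class of generalized Bernstein functions of order `lam > 0`: smooth functions
`f : (0, ∞) → (0, ∞)` for which `x ^ (1 - lam) * f'(x)` is completely monotonic.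
Order `1` gives the (strictly positive) Bernstein functions. -/
def GenBernstein (lam : ℝ) (f : ℝ → ℝ) : Prop :=
  ContDiffOn ℝ ∞ f (Ioi 0) ∧ (∀ x : ℝ, 0 < x → 0 < f x) ∧
    CompletelyMonotonic (fun x => x ^ (1 - lam) * deriv f x)

/-- `g` is, on `(0, ∞)`, the Laplace transform of the function `u` on `(0, ∞)`; the
defining integral is required to converge for every `x > 0`. -/
def IsLaplaceTransformOf (g u : ℝ → ℝ) : Prop :=
  ∀ x : ℝ, 0 < x → IntegrableOn (fun t => Real.exp (-(x * t)) * u t) (Ioi 0) ∧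
    g x = ∫ t in Ioi (0 : ℝ), Real.exp (-(x * t)) * u t

/-- A function `u : (0, ∞) → (0, ∞)` is logarithmically convex if `log u` is convex. -/
def LogConvexOnPos (u : ℝ → ℝ) : Prop :=
  (∀ t : ℝ, 0 < t → 0 < u t) ∧ ConvexOn ℝ (Ioi 0) (fun t => Real.log (u t))

/-- The class `C_α`, for `α ≥ 0`: functions `f : (0, ∞) → (0, ∞)` such that `x ^ α * f(x)` is the
Laplace transform of a decreasing (in the wide sense) and logarithmically convex function
on `(0, ∞)`. -/
def ClassC (α : ℝ) (f : ℝ → ℝ) : Prop :=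
  (∀ x : ℝ, 0 < x → 0 < f x) ∧
    ∃ u : ℝ → ℝ, AntitoneOn u (Ioi 0) ∧ LogConvexOnPos u ∧
      IsLaplaceTransformOf (fun x => x ^ α * f x) u

/-! Put φ(x) = x^α f(x), the Laplace transform of u. With z = e^{-hx}, φ(x) is the limit as h → 0 of
Riemann sums h A(z), where the power series A has coefficients u((n+1)h): positive, nonincreasing
and log-convex. Kaluza's theorem makes the coefficients of 1/A nonpositive after the constant one.
Monotonicity of the coefficients gives the same for (1 - z)A and, combined with Kaluza, makes those
of 1/((1 - z)A) nonnegative. Since (1 - z)/h → x, the three series determine in the limit the signs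
for xφ, 1/φ and 1/(xφ).

Signs are carried by iterated differences, which, unlike derivatives, pass to pointwise limits;
smoothness of φ, proved separately, converts them back to derivatives. Then (a) and (c) follow from
x^{α+1} f = xφ, and (b) from x^{-α}(1/f)' = α/(xφ) + (1/φ)'. -/

open Filter Topology

/-! ### Iterated differences and complete monotonicity -/

/-- Iterated differences `g x - g (x + s)`, one for every step `s` of the list. -/
def altDiff : List ℝ → (ℝ → ℝ) → ℝ → ℝ
  | [], g => g
  | s :: l, g => fun x => altDiff l g x - altDiff l g (x + s)

/-- All iterated differences of `g` on `(0, ∞)` with positive steps are nonnegative. -/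
def AltMonotone (g : ℝ → ℝ) : Prop :=
  ∀ l : List ℝ, (∀ s ∈ l, 0 < s) → ∀ x : ℝ, 0 < x → 0 ≤ altDiff l g x

/-- All iterated differences of `g` of order at least one are nonnegative on `(0, ∞)`. -/
def AltMonotoneDiff (g : ℝ → ℝ) : Prop :=
  ∀ s : ℝ, ∀ l : List ℝ, 0 < s → (∀ s ∈ l, 0 < s) → ∀ x : ℝ, 0 < x → 0 ≤ altDiff (s :: l) g x

lemma AltMonotone.diff {g : ℝ → ℝ} (hg : AltMonotone g) : AltMonotoneDiff g :=
  fun s l hs hl x hx => hg (s :: l) (by simpa using ⟨hs, hl⟩) x hx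

lemma altDiff_congr {g g' : ℝ → ℝ} (h : EqOn g g' (Ioi 0)) {l : List ℝ} (hl : ∀ s ∈ l, 0 < s)
    {x : ℝ} (hx : 0 < x) : altDiff l g x = altDiff l g' x := by
  induction l generalizing x with
  | nil => exact h hx
  | cons s l ih =>
    simp only [List.mem_cons, forall_eq_or_imp] at hl
    simp only [altDiff, ih hl.2 hx, ih hl.2 (add_pos hx hl.1)]

lemma AltMonotone.congr {g g' : ℝ → ℝ} (hg : AltMonotone g) (h : EqOn g' g (Ioi 0)) :
    AltMonotone g' := fun l hl x hx => by
  rw [altDiff_congr h hl hx]; exact hg l hl x hx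

lemma AltMonotoneDiff.congr {g g' : ℝ → ℝ} (hg : AltMonotoneDiff g) (h : EqOn g' g (Ioi 0)) :
    AltMonotoneDiff g' := fun s l hs hl x hx => by
  rw [altDiff_congr h (by simpa using ⟨hs, hl⟩) hx]; exact hg s l hs hl x hx

lemma altDiff_const_mul_add (c : ℝ) (g g' : ℝ → ℝ) (l : List ℝ) (x : ℝ) :
    altDiff l (fun y => c * g y + g' y) x = c * altDiff l g x + altDiff l g' x := by
  induction l generalizing x with
  | nil => rfl
  | cons s l ih => simp only [altDiff, ih]; ring

lemma AltMonotone.const_mul_add {c : ℝ} (hc : 0 ≤ c) {g g' : ℝ → ℝ} (hg : AltMonotone g)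
    (hg' : AltMonotone g') : AltMonotone (fun y => c * g y + g' y) := fun l hl x hx => by
  rw [altDiff_const_mul_add]
  exact add_nonneg (mul_nonneg hc (hg l hl x hx)) (hg' l hl x hx)

lemma tendsto_altDiff {ι : Type*} {F : Filter ι} {G : ι → ℝ → ℝ} {g : ℝ → ℝ}
    (h : ∀ x, 0 < x → Tendsto (fun i => G i x) F (𝓝 (g x))) {l : List ℝ} (hl : ∀ s ∈ l, 0 < s)
    {x : ℝ} (hx : 0 < x) : Tendsto (fun i => altDiff l (G i) x) F (𝓝 (altDiff l g x)) := by
  induction l generalizing x with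
  | nil => exact h x hx
  | cons s l ih =>
    simp only [List.mem_cons, forall_eq_or_imp] at hl
    exact (ih hl.2 hx).sub (ih hl.2 (add_pos hx hl.1))

lemma AltMonotone.of_tendsto {ι : Type*} {F : Filter ι} [F.NeBot] {G : ι → ℝ → ℝ} {g : ℝ → ℝ}
    (h : ∀ x, 0 < x → Tendsto (fun i => G i x) F (𝓝 (g x))) (hG : ∀ i, AltMonotone (G i)) :
    AltMonotone g := fun l hl x hx =>
  ge_of_tendsto' (tendsto_altDiff h hl hx) fun i => hG i l hl x hx

lemma AltMonotoneDiff.of_tendsto {ι : Type*} {F : Filter ι} [F.NeBot] {G : ι → ℝ → ℝ}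
    {g : ℝ → ℝ} (h : ∀ x, 0 < x → Tendsto (fun i => G i x) F (𝓝 (g x)))
    (hG : ∀ i, AltMonotoneDiff (G i)) : AltMonotoneDiff g := fun s l hs hl x hx =>
  ge_of_tendsto' (tendsto_altDiff h (l := s :: l) (by simpa using ⟨hs, hl⟩) hx)
    fun i => hG i s l hs hl x hx

lemma hasDerivAt_altDiff {g g' : ℝ → ℝ} (h : ∀ x, 0 < x → HasDerivAt g (g' x) x) {l : List ℝ}
    (hl : ∀ s ∈ l, 0 < s) {x : ℝ} (hx : 0 < x) :
    HasDerivAt (altDiff l g) (altDiff l g' x) x := by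
  induction l generalizing x with
  | nil => exact h x hx
  | cons s l ih =>
    simp only [List.mem_cons, forall_eq_or_imp] at hl
    exact (ih hl.2 hx).sub ((ih hl.2 (add_pos hx hl.1)).comp_add_const x s)

lemma altDiff_neg (g : ℝ → ℝ) (l : List ℝ) (x : ℝ) :
    altDiff l (fun y => -g y) x = -altDiff l g x := by
  induction l generalizing x with
  | nil => rfl
  | cons s l ih => simp only [altDiff, ih]; ring

/-- Differencing commutes with differentiation, and nonnegativity of one further difference makes
every iterated difference of `g` nonincreasing, so its derivative is nonpositive. -/
lemma AltMonotoneDiff.neg_deriv {g g' : ℝ → ℝ} (hg : AltMonotoneDiff g)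
    (h : ∀ x, 0 < x → HasDerivAt g (g' x) x) : AltMonotone (fun x => -g' x) := by
  intro l hl x hx
  rw [altDiff_neg, neg_nonneg]
  have hd := hasDerivAt_altDiff h hl hx
  have hanti : AntitoneOn (altDiff l g) (Ioi 0) := by
    intro y hy z hz hyz
    rcases hyz.eq_or_lt with rfl | hlt
    · rfl
    · have := hg (z - y) l (sub_pos.2 hlt) hl y hy
      simp only [altDiff, add_sub_cancel] at this
      linarith
  have h0 := hanti.derivWithin_nonpos (x := x)
  rwa [derivWithin_of_isOpen isOpen_Ioi hx, hd.deriv] at h0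

lemma AltMonotone.completelyMonotonic {g : ℝ → ℝ} (hg : AltMonotone g)
    (hs : ContDiffOn ℝ ∞ g (Ioi 0)) : CompletelyMonotonic g := by
  refine ⟨hs, fun n => ?_⟩
  induction n generalizing g with
  | zero => intro x hx; simpa [altDiff] using hg [] (by simp) x hx
  | succ n ih =>
    intro x hx
    have hd : ContDiffOn ℝ ∞ (derivWithin g (Ioi 0)) (Ioi 0) :=
      hs.derivWithin (uniqueDiffOn_Ioi 0) (by simp)
    have hD : AltMonotone (fun x => -derivWithin g (Ioi 0) x) :=
      hg.diff.neg_deriv fun x hx =>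
        ((hs.differentiableOn (by simp)) x hx).hasDerivWithinAt.hasDerivAt (Ioi_mem_nhds hx)
    have := ih hD hd.neg x hx
    rw [iteratedDerivWithin_succ']
    have e : iteratedDerivWithin n (fun x => -derivWithin g (Ioi 0) x) (Ioi 0) x =
        -iteratedDerivWithin n (derivWithin g (Ioi 0)) (Ioi 0) x :=
      iteratedDerivWithin_fun_neg _
    rw [e] at this
    rw [pow_succ]; linarith

/-! ### Power series in exp(-hx) -/

/-- Exponentials are eigenfunctions: a difference of step s multiplies e^{-nhx} by 1 - e^{-nhs}. -/
lemma hasSum_altDiff {h : ℝ} {b : ℕ → ℝ} {g : ℝ → ℝ}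
    (hg : ∀ x, 0 < x → HasSum (fun n => b n * Real.exp (-(h * x)) ^ n) (g x)) {l : List ℝ}
    (hl : ∀ s ∈ l, 0 < s) {x : ℝ} (hx : 0 < x) :
    HasSum (fun n => b n * Real.exp (-(h * x)) ^ n *
      (l.map fun s => 1 - Real.exp (-(h * s)) ^ n).prod) (altDiff l g x) := by
  induction l generalizing x with
  | nil => simpa [altDiff] using hg x hx
  | cons s l ih =>
    simp only [List.mem_cons, forall_eq_or_imp] at hl
    refine ((ih hl.2 hx).sub (ih hl.2 (add_pos hx hl.1))).congr_fun ?_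
    intro n
    rw [mul_add, neg_add, Real.exp_add, mul_pow, List.map_cons, List.prod_cons]
    ring

lemma list_prod_one_sub_exp_nonneg {h : ℝ} (hh : 0 ≤ h) {l : List ℝ} (hl : ∀ s ∈ l, 0 < s)
    (n : ℕ) : 0 ≤ (l.map fun s => 1 - Real.exp (-(h * s)) ^ n).prod := by
  refine List.prod_nonneg fun y hy => ?_
  obtain ⟨s, hs, rfl⟩ := List.mem_map.1 hy
  rw [sub_nonneg]
  refine pow_le_one₀ (Real.exp_pos _).le (Real.exp_le_one_iff.2 ?_)
  have := mul_nonneg hh (hl s hs).le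
  linarith

lemma AltMonotone.of_hasSum {h : ℝ} (hh : 0 ≤ h) {b : ℕ → ℝ} (hb : ∀ n, 0 ≤ b n) {g : ℝ → ℝ}
    (hg : ∀ x, 0 < x → HasSum (fun n => b n * Real.exp (-(h * x)) ^ n) (g x)) :
    AltMonotone g := fun _ hl _ hx =>
  (hasSum_altDiff hg hl hx).nonneg fun n => mul_nonneg
    (mul_nonneg (hb n) (pow_nonneg (Real.exp_pos _).le n)) (list_prod_one_sub_exp_nonneg hh hl n)

lemma AltMonotoneDiff.of_hasSum {h : ℝ} (hh : 0 ≤ h) {b : ℕ → ℝ} (hb : ∀ n, 0 ≤ b (n + 1))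
    {g : ℝ → ℝ} (hg : ∀ x, 0 < x → HasSum (fun n => b n * Real.exp (-(h * x)) ^ n) (g x)) :
    AltMonotoneDiff g := by
  intro s l hs hl x hx
  have hl' : ∀ t ∈ s :: l, 0 < t := by simpa using ⟨hs, hl⟩
  refine (hasSum_altDiff hg hl' hx).nonneg fun n => ?_
  cases n with
  -- The constant term is killed by the first difference, so the sign of `b 0` is irrelevant.
  | zero => simp
  | succ n =>
    exact mul_nonneg (mul_nonneg (hb n) (pow_nonneg (Real.exp_pos _).le _))
      (list_prod_one_sub_exp_nonneg hh hl' _)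

/-! ### Kaluza's theorem and reciprocal power series -/

open Finset in
/-- Kaluza's theorem: the reciprocal of a power series with log-convex positive coefficients has
nonpositive coefficients after the constant one. -/
lemma exists_reciprocal_coeff_of_logConvex {a : ℕ → ℝ} (ha : ∀ n, 0 < a n)
    (hlog : ∀ n, a (n + 1) * a (n + 1) ≤ a n * a (n + 2)) :
    ∃ c : ℕ → ℝ, c 0 = (a 0)⁻¹ ∧ (∀ n, c (n + 1) ≤ 0) ∧
      ∀ n, ∑ k ∈ range (n + 1), c k * a (n - k) = if n = 0 then 1 else 0 := by
  have hratio : Monotone fun n => a (n + 1) / a n := monotone_nat_of_le_succ fun n => by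
    rw [div_le_div_iff₀ (ha _) (ha _)]; linarith [hlog n, mul_comm (a n) (a (n + 2))]
  set A : PowerSeries ℝ := PowerSeries.mk a
  have hA : A⁻¹ * A = 1 := PowerSeries.inv_mul_cancel A (by simpa [A] using (ha 0).ne')
  have hconv : ∀ n, ∑ k ∈ range (n + 1), PowerSeries.coeff k A⁻¹ * a (n - k) =
      if n = 0 then 1 else 0 := by
    intro n
    have := congrArg (PowerSeries.coeff n) hA
    rw [PowerSeries.coeff_mul, PowerSeries.coeff_one,
      Finset.Nat.sum_antidiagonal_eq_sum_range_succ_mk] at this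
    simpa [A] using this
  set c : ℕ → ℝ := fun n => PowerSeries.coeff n A⁻¹ with hc
  have hc0 : c 0 = (a 0)⁻¹ := by
    have := hconv 0
    simp only [zero_add, range_one, sum_singleton, Nat.sub_zero, if_true] at this
    exact eq_inv_of_mul_eq_one_left this
  refine ⟨c, hc0, fun n => ?_, hconv⟩
  induction n using Nat.strong_induction_on with
  | _ n ih =>
    have h1 : c (n + 1) * a 0 = -∑ k ∈ range (n + 1), c k * a (n + 1 - k) := by
      have := hconv (n + 1)
      rw [sum_range_succ] at this
      simp only [Nat.sub_self, Nat.add_eq_zero_iff, one_ne_zero, and_false, if_false] at this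
      linarith
    suffices 0 ≤ ∑ k ∈ range (n + 1), c k * a (n + 1 - k) by
      by_contra! hcon
      have := mul_pos hcon (ha 0)
      linarith
    -- Scale the degree n convolution identity by the largest ratio a(n+1)/a(n): the k = 0 terms
    -- agree, and for k ≥ 1 the ratio bound is reversed by c(k) ≤ 0.
    have h2 : a (n + 1) / a n * ∑ k ∈ range (n + 1), c k * a (n - k) ≤
        ∑ k ∈ range (n + 1), c k * a (n + 1 - k) := by
      rw [mul_sum]
      refine sum_le_sum fun k hk => ?_
      rw [Finset.mem_range] at hk
      cases k with
      | zero =>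
        refine le_of_eq ?_
        have := (ha n).ne'
        simp only [Nat.sub_zero]
        field_simp
      | succ k =>
        have e : n + 1 - (k + 1) = n - (k + 1) + 1 := by omega
        have h3 : a (n - (k + 1) + 1) ≤ a (n + 1) / a n * a (n - (k + 1)) := by
          rw [← div_le_iff₀ (ha _)]
          exact hratio (Nat.sub_le _ _)
        rw [e]
        have := mul_le_mul_of_nonpos_left h3 (ih k (by omega))
        linarith
    refine le_trans ?_ h2
    rw [hconv]
    have := div_pos (ha (n + 1)) (ha n)
    split_ifs <;> simp [this.le]

-- In the convolution identity of positive degree n, the terms with 0 < k < n are nonpositive, so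
-- -c(n) a(0) ≤ c(0) a(n) ≤ 1. This bound gives convergence of the reciprocal series on [0, 1).
open Finset in
lemma abs_reciprocal_coeff_le {a c : ℕ → ℝ} (ha : ∀ n, 0 < a n) (hanti : Antitone a)
    (hc0 : c 0 = (a 0)⁻¹) (hc : ∀ n, c (n + 1) ≤ 0)
    (hconv : ∀ n, ∑ k ∈ range (n + 1), c k * a (n - k) = if n = 0 then 1 else 0) (n : ℕ) :
    |c n| ≤ (a 0)⁻¹ := by
  cases n with
  | zero => rw [hc0, abs_of_pos (inv_pos.2 (ha 0))]
  | succ n =>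
    rw [abs_of_nonpos (hc n)]
    have h := hconv (n + 1)
    rw [sum_range_succ, sum_range_succ'] at h
    simp only [Nat.sub_self, Nat.add_eq_zero_iff, one_ne_zero, and_false, if_false,
      Nat.sub_zero] at h
    have h1 : ∑ k ∈ range n, c (k + 1) * a (n + 1 - (k + 1)) ≤ 0 :=
      sum_nonpos fun k _ => mul_nonpos_of_nonpos_of_nonneg (hc k) (ha _).le
    have h2 : c 0 * a (n + 1) ≤ 1 := by
      rw [hc0, inv_mul_le_iff₀ (ha 0), mul_one]; exact hanti (Nat.zero_le _)
    rw [← one_div, le_div_iff₀ (ha 0)]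
    linarith

-- Replacing a(n - k) by the smaller a(n) can only increase the convolution sum, since c(k) ≤ 0 for
-- k ≥ 1.
open Finset in
lemma sum_reciprocal_coeff_nonneg {a c : ℕ → ℝ} (ha : ∀ n, 0 < a n) (hanti : Antitone a)
    (hc : ∀ n, c (n + 1) ≤ 0)
    (hconv : ∀ n, ∑ k ∈ range (n + 1), c k * a (n - k) = if n = 0 then 1 else 0) (n : ℕ) :
    0 ≤ ∑ k ∈ range (n + 1), c k := by
  refine nonneg_of_mul_nonneg_left (b := a n) ?_ (ha n)
  calc (0 : ℝ) ≤ ∑ k ∈ range (n + 1), c k * a (n - k) := by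
        rw [hconv]; split_ifs <;> simp
    _ ≤ (∑ k ∈ range (n + 1), c k) * a n := by
        rw [sum_mul]
        refine sum_le_sum fun k _ => ?_
        cases k with
        | zero => simp
        | succ k => exact mul_le_mul_of_nonpos_left (hanti (Nat.sub_le _ _)) (hc k)

lemma summable_norm_mul_pow_of_abs_le {b : ℕ → ℝ} {M : ℝ} (hb : ∀ n, |b n| ≤ M) {z : ℝ}
    (h0 : 0 ≤ z) (h1 : z < 1) : Summable fun n => ‖b n * z ^ n‖ := by
  refine Summable.of_nonneg_of_le (fun _ => norm_nonneg _) (fun n => ?_)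
    ((summable_geometric_of_lt_one h0 h1).mul_left M)
  rw [norm_mul, norm_pow, Real.norm_eq_abs, Real.norm_eq_abs, abs_of_nonneg h0]
  exact mul_le_mul_of_nonneg_right (hb n) (pow_nonneg h0 n)

open Finset in
lemma hasSum_mul_pow_cauchy {b c : ℕ → ℝ} {z : ℝ} (hb : Summable fun n => ‖b n * z ^ n‖)
    (hc : Summable fun n => ‖c n * z ^ n‖) :
    HasSum (fun n => (∑ k ∈ range (n + 1), b k * c (n - k)) * z ^ n)
      ((∑' n, b n * z ^ n) * ∑' n, c n * z ^ n) := by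
  refine (hasSum_sum_range_mul_of_summable_norm hb hc).congr_fun fun n => ?_
  rw [sum_mul]
  refine sum_congr rfl fun k hk => ?_
  have e : z ^ n = z ^ k * z ^ (n - k) := by
    rw [← pow_add, Nat.add_sub_cancel' (by simpa [Nat.lt_succ_iff] using hk)]
  rw [e]; ring

open Finset in
/-- Expansions of `1 / A(z)`, `1 / ((1 - z) A(z))` and `(1 - z) A(z)` for a power series with
positive, nonincreasing and log-convex coefficients. -/
lemma exists_kaluza_expansions {a : ℕ → ℝ} (ha : ∀ n, 0 < a n) (hanti : Antitone a)
    (hlog : ∀ n, a (n + 1) * a (n + 1) ≤ a n * a (n + 2)) :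
    ∃ c e d : ℕ → ℝ, (∀ n, c (n + 1) ≤ 0) ∧ (∀ n, 0 ≤ e n) ∧ (∀ n, d (n + 1) ≤ 0) ∧
      ∀ z : ℝ, 0 ≤ z → z < 1 →
        HasSum (fun n => c n * z ^ n) (1 / ∑' n, a n * z ^ n) ∧
        HasSum (fun n => e n * z ^ n) (1 / ((1 - z) * ∑' n, a n * z ^ n)) ∧
        HasSum (fun n => d n * z ^ n) ((1 - z) * ∑' n, a n * z ^ n) := by
  obtain ⟨c, hc0, hc, hconv⟩ := exists_reciprocal_coeff_of_logConvex ha hlog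
  -- Dividing by 1 - z takes partial sums of coefficients; multiplying by it takes backward
  -- differences. The case n = 0 is separate because truncated subtraction would read a(-1) as a(0).
  refine ⟨c, fun n => ∑ k ∈ range (n + 1), c k, fun n => a n - if n = 0 then 0 else a (n - 1),
    hc, sum_reciprocal_coeff_nonneg ha hanti hc hconv, fun n => ?_, fun z h0 h1 => ?_⟩
  · simpa using hanti (Nat.le_succ n)
  have hsa : Summable fun n => ‖a n * z ^ n‖ :=
    summable_norm_mul_pow_of_abs_le (M := a 0)
      (fun n => by rw [abs_of_pos (ha n)]; exact hanti (Nat.zero_le n)) h0 h1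
  have hsc : Summable fun n => ‖c n * z ^ n‖ :=
    summable_norm_mul_pow_of_abs_le (abs_reciprocal_coeff_le ha hanti hc0 hc hconv) h0 h1
  have hs1 : Summable fun n => ‖(1 : ℝ) * z ^ n‖ :=
    summable_norm_mul_pow_of_abs_le (b := fun _ => 1) (M := 1) (fun n => by simp) h0 h1
  have hprod : (∑' n, c n * z ^ n) * ∑' n, a n * z ^ n = 1 := by
    refine (hasSum_mul_pow_cauchy hsc hsa).unique ?_
    simp_rw [hconv]
    convert hasSum_ite_eq (0 : ℕ) (1 : ℝ) using 2 with n
    split_ifs with h <;> simp [h]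
  have hinv : ∑' n, c n * z ^ n = 1 / ∑' n, a n * z ^ n := eq_one_div_of_mul_eq_one_left hprod
  have hgeom : ∑' n, (1 : ℝ) * z ^ n = (1 - z)⁻¹ := by
    simp [tsum_geometric_of_lt_one h0 h1]
  refine ⟨hinv ▸ hsc.of_norm.hasSum, ?_, ?_⟩
  · have := hasSum_mul_pow_cauchy (c := fun _ => 1) hsc hs1
    rw [hgeom, hinv, one_div_mul_eq_div, div_eq_mul_inv, ← mul_inv] at this
    simpa using this
  · have hA := hsa.of_norm.hasSum
    have hB : HasSum (fun n => (if n = 0 then 0 else a (n - 1)) * z ^ n)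
        (z * ∑' n, a n * z ^ n) := by
      rw [← hasSum_nat_add_iff' 1]
      simp only [Finset.range_one, sum_singleton, if_true, zero_mul, sub_zero]
      refine (hA.mul_left z).congr_fun fun n => ?_
      simp [pow_succ]; ring
    have := hA.sub hB
    rw [show (1 - z) * ∑' n, a n * z ^ n = (∑' n, a n * z ^ n) - z * ∑' n, a n * z ^ n by ring]
    refine this.congr_fun fun n => ?_
    ring

/-! ### Smoothness of Laplace transforms -/

/-- A Laplace transform of a nonnegative function that converges on `(0, ∞)` is smooth there. -/
lemma contDiffOn_laplace {φ u : ℝ → ℝ} (hu : ∀ t, 0 < t → 0 ≤ u t)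
    (h : IsLaplaceTransformOf φ u) : ContDiffOn ℝ ∞ φ (Ioi 0) := by
  have hum : AEMeasurable u (volume.restrict (Ioi 0)) := by
    have h1 := (h 1 one_pos).1.aestronglyMeasurable.aemeasurable
    have h2 : AEMeasurable (fun t : ℝ => Real.exp (1 * t)) (volume.restrict (Ioi 0)) := by
      fun_prop
    refine (h2.mul h1).congr (ae_of_all _ fun t => ?_)
    simp [← mul_assoc, ← Real.exp_add]
  -- φ(x) is the moment generating function at -x of the measure with density u, hence analytic
  -- wherever -x is interior to the integrability set.
  set μ : Measure ℝ := (volume.restrict (Ioi 0)).withDensity fun t => ENNReal.ofReal (u t) with hμ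
  have hlt : ∀ᵐ t ∂volume.restrict (Ioi (0 : ℝ)), ENNReal.ofReal (u t) < ⊤ :=
    ae_of_all _ fun t => ENNReal.ofReal_lt_top
  have hint : ∀ x : ℝ, x < 0 → Integrable (fun t => Real.exp (x * t)) μ := fun x hx => by
    rw [hμ, integrable_withDensity_iff_integrable_smul₀' hum.ennreal_ofReal hlt]
    refine (h (-x) (neg_pos.2 hx)).1.congr ?_
    filter_upwards [ae_restrict_mem measurableSet_Ioi] with t ht
    rw [ENNReal.toReal_ofReal (hu t ht), smul_eq_mul, mul_comm]
    simp
  have hφ : ∀ x ∈ Ioi (0 : ℝ), φ x = ProbabilityTheory.mgf (fun t => t) μ (-x) := by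
    intro x hx
    rw [(h x hx).2, ProbabilityTheory.mgf, hμ,
      integral_withDensity_eq_integral_toReal_smul₀ hum.ennreal_ofReal hlt]
    refine integral_congr_ae ?_
    filter_upwards [ae_restrict_mem measurableSet_Ioi] with t ht
    rw [ENNReal.toReal_ofReal (hu t ht), smul_eq_mul, mul_comm]
    simp
  refine ContDiffOn.congr (fun x hx => ?_) hφ
  have hmem : -x ∈ interior (ProbabilityTheory.integrableExpSet (fun t => t) μ) := by
    refine interior_mono (s := Iio 0) (fun y hy => hint y hy) ?_
    rw [interior_Iio]; exact neg_lt_zero.2 (mem_Ioi.1 hx)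
  have := (ProbabilityTheory.analyticAt_mgf hmem).contDiffAt (n := ∞)
  exact (this.comp x contDiff_neg.contDiffAt).contDiffWithinAt

/-! ### Riemann sums converging to the Laplace transform -/

-- Compare each right-endpoint rectangle with the integrals over the two adjacent cells. Right
-- endpoints avoid 0, where F may blow up.
open Finset in
lemma AntitoneOn.tsum_mul_le_integral_Ioi {F : ℝ → ℝ} (hF : AntitoneOn F (Ioi 0))
    (h0 : ∀ t, 0 < t → 0 ≤ F t) (hi : IntegrableOn F (Ioi 0)) {h : ℝ} (hh : 0 < h)
    (hs : Summable fun n : ℕ => h * F ((n + 1 : ℝ) * h)) :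
    ∫ t in Ioi h, F t ≤ ∑' n : ℕ, h * F ((n + 1 : ℝ) * h) ∧
      ∑' n : ℕ, h * F ((n + 1 : ℝ) * h) ≤ ∫ t in Ioi 0, F t := by
  have hii : ∀ a b : ℝ, 0 ≤ a → 0 ≤ b → IntervalIntegrable F volume a b := fun a b ha hb =>
    ⟨hi.mono_set fun t ht => ha.trans_lt ht.1, hi.mono_set fun t ht => hb.trans_lt ht.1⟩
  have hpos : ∀ n : ℕ, 0 < (n + 1 : ℝ) * h := fun n => by positivity
  have hpos' : ∀ n : ℕ, 0 ≤ (n : ℝ) * h := fun n => by positivity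
  have hstep : ∀ n : ℕ, ((n + 1 : ℝ) * h) = n * h + h := fun n => by ring
  constructor
  · have hlim : Tendsto (fun N : ℕ => ∫ t in h..(((N : ℕ) : ℝ) + 1) * h, F t) atTop
        (𝓝 (∫ t in Ioi h, F t)) := by
      refine intervalIntegral_tendsto_integral_Ioi h
        (hi.mono_set (Ioi_subset_Ioi hh.le)) ?_
      exact (tendsto_atTop_add_const_right _ _ tendsto_natCast_atTop_atTop).atTop_mul_const hh
    refine le_of_tendsto' hlim fun N => ?_
    have hadj := intervalIntegral.sum_integral_adjacent_intervals (f := F) (μ := volume)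
      (a := fun n : ℕ => ((n : ℝ) + 1) * h) (n := N)
      (fun k _ => hii _ _ (hpos k).le (hpos (k + 1)).le)
    simp only [Nat.cast_zero, zero_add, one_mul] at hadj
    rw [← hadj]
    refine le_trans (Finset.sum_le_sum fun k _ => ?_)
      (hs.sum_le_tsum (range N) fun n _ => mul_nonneg hh.le (h0 _ (hpos n)))
    have hle : ((k : ℝ) + 1) * h ≤ (((k + 1 : ℕ) : ℝ) + 1) * h := by
      push_cast; nlinarith
    calc ∫ t in ((k : ℝ) + 1) * h..(((k + 1 : ℕ) : ℝ) + 1) * h, F t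
        ≤ ∫ t in ((k : ℝ) + 1) * h..(((k + 1 : ℕ) : ℝ) + 1) * h, F (((k : ℝ) + 1) * h) :=
          intervalIntegral.integral_mono_on hle (hii _ _ (hpos k).le (hpos (k + 1)).le)
            intervalIntegrable_const
            fun t ht => hF (hpos k) ((hpos k).trans_le ht.1) ht.1
      _ = h * F (((k : ℝ) + 1) * h) := by
          rw [intervalIntegral.integral_const, smul_eq_mul]; push_cast; ring
  · refine Real.tsum_le_of_sum_range_le (fun n => mul_nonneg hh.le (h0 _ (hpos n))) fun N => ?_
    have hadj := intervalIntegral.sum_integral_adjacent_intervals (f := F) (μ := volume)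
      (a := fun n : ℕ => (n : ℝ) * h) (n := N)
      (fun k _ => hii _ _ (hpos' k) (hpos' (k + 1)))
    simp only [Nat.cast_zero, zero_mul] at hadj
    have hle' : ∫ t in (0 : ℝ)..(N : ℝ) * h, F t ≤ ∫ t in Ioi 0, F t := by
      rw [intervalIntegral.integral_of_le (hpos' N)]
      refine setIntegral_mono_set hi ?_ (ae_of_all _ Ioc_subset_Ioi_self)
      filter_upwards [ae_restrict_mem measurableSet_Ioi] with t ht using h0 t ht
    refine le_trans ?_ hle'
    rw [← hadj]
    refine Finset.sum_le_sum fun k _ => ?_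
    have hle : (k : ℝ) * h ≤ ((k + 1 : ℕ) : ℝ) * h := by
      push_cast; nlinarith
    calc h * F (((k : ℝ) + 1) * h)
        = ∫ t in (k : ℝ) * h..((k + 1 : ℕ) : ℝ) * h, F (((k : ℝ) + 1) * h) := by
          rw [intervalIntegral.integral_const, smul_eq_mul]; push_cast; ring
      _ ≤ ∫ t in (k : ℝ) * h..((k + 1 : ℕ) : ℝ) * h, F t := by
          -- The open cell is needed: for k = 0 the left endpoint is 0, where F is not controlled.
          refine intervalIntegral.integral_mono_on_of_le_Ioo hle intervalIntegrable_const
            (hii _ _ (hpos' k) (hpos' (k + 1))) fun t ht => ?_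
          refine hF ((hpos' k).trans_lt ht.1) (hpos k) ?_
          have := ht.2.le
          push_cast at this
          exact this

lemma tendsto_setIntegral_Ioi_zero {ι : Type*} {l : Filter ι} {F : ℝ → ℝ}
    (hi : IntegrableOn F (Ioi 0)) {h : ι → ℝ} (hpos : ∀ i, 0 < h i) (hlim : Tendsto h l (𝓝 0)) :
    Tendsto (fun i => ∫ t in Ioi (h i), F t) l (𝓝 (∫ t in Ioi 0, F t)) := by
  have hii : IntegrableOn F (Icc 0 1) := by
    rw [integrableOn_Icc_iff_integrableOn_Ioc]
    exact hi.mono_set Ioc_subset_Ioi_self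
  have hc := (intervalIntegral.continuousOn_primitive hii) 0 (by simp)
  have hle : ∀ᶠ i in l, h i ∈ Icc (0 : ℝ) 1 := by
    filter_upwards [hlim.eventually (Iio_mem_nhds one_pos)] with i hlt
    exact ⟨(hpos i).le, le_of_lt hlt⟩
  have h1 := hc.tendsto.comp (tendsto_nhdsWithin_iff.2 ⟨hlim, hle⟩)
  have h2 := h1.const_sub (∫ t in Ioi 0, F t)
  simp only [Ioc_self, Measure.restrict_empty, integral_zero_measure, sub_zero] at h2
  refine h2.congr fun i => ?_
  have := setIntegral_union (f := F) (μ := volume) (Ioc_disjoint_Ioi (a := 0) (le_refl (h i)))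
    measurableSet_Ioi (hi.mono_set Ioc_subset_Ioi_self)
    (hi.mono_set (Ioi_subset_Ioi (hpos i).le))
  rw [Ioc_union_Ioi_eq_Ioi (hpos i).le] at this
  simp only [Function.comp]
  linarith

lemma AntitoneOn.logConvex_sample {u : ℝ → ℝ} (hanti : AntitoneOn u (Ioi 0))
    (hlc : LogConvexOnPos u) {h : ℝ} (hh : 0 < h) :
    (∀ n : ℕ, 0 < u ((n + 1 : ℝ) * h)) ∧ Antitone (fun n : ℕ => u ((n + 1 : ℝ) * h)) ∧
      ∀ n : ℕ, u (((n + 1 : ℕ) + 1 : ℝ) * h) * u (((n + 1 : ℕ) + 1 : ℝ) * h) ≤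
        u ((n + 1 : ℝ) * h) * u (((n + 2 : ℕ) + 1 : ℝ) * h) := by
  have hpos : ∀ n : ℕ, 0 < (n + 1 : ℝ) * h := fun n => by positivity
  refine ⟨fun n => hlc.1 _ (hpos n), fun m n hmn => hanti (hpos m) (hpos n) ?_, fun n => ?_⟩
  · gcongr
  · have hu := fun n => hlc.1 _ (hpos n)
    have hconv := hlc.2.2
    have := hconv (mem_Ioi.2 (hpos n)) (mem_Ioi.2 (hpos (n + 2))) (a := 1 / 2) (b := 1 / 2) (by norm_num)
      (by norm_num) (by norm_num)
    have e : (1 / 2 : ℝ) • ((n + 1 : ℝ) * h) + (1 / 2 : ℝ) • (((n + 2 : ℕ) + 1 : ℝ) * h) =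
        ((n + 1 : ℕ) + 1 : ℝ) * h := by
      simp only [smul_eq_mul]; push_cast; ring
    rw [e] at this
    simp only [smul_eq_mul] at this
    rw [← Real.log_le_log_iff (mul_pos (hu _) (hu _)) (mul_pos (hu _) (hu _)),
      Real.log_mul (hu _).ne' (hu _).ne', Real.log_mul (hu _).ne' (hu _).ne']
    linarith

/-- The sampled power series converge to the Laplace transform. -/
lemma tendsto_sampled_laplace {φ u : ℝ → ℝ} (hanti : AntitoneOn u (Ioi 0))
    (hpos : ∀ t, 0 < t → 0 < u t) (hL : IsLaplaceTransformOf φ u) {h : ℕ → ℝ}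
    (hh : ∀ m, 0 < h m) (hlim : Tendsto h atTop (𝓝 0)) {x : ℝ} (hx : 0 < x) :
    Tendsto (fun m => h m * ∑' n : ℕ, u ((n + 1 : ℝ) * h m) * Real.exp (-(h m * x)) ^ n) atTop
      (𝓝 (φ x)) := by
  set F : ℝ → ℝ := fun t => Real.exp (-(x * t)) * u t with hF
  have hi : IntegrableOn F (Ioi 0) := (hL x hx).1
  have hFpos : ∀ t, 0 < t → 0 ≤ F t := fun t ht => mul_nonneg (Real.exp_pos _).le (hpos t ht).le
  have hFanti : AntitoneOn F (Ioi 0) := fun s hs t ht hst =>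
    mul_le_mul (Real.exp_le_exp.2 (neg_le_neg (mul_le_mul_of_nonneg_left hst hx.le)))
      (hanti hs ht hst) (hpos t ht).le (Real.exp_pos _).le
  -- Samples start at h, not 0, which leaves an extra factor e^{-hx} that tends to 1.
  have hterm : ∀ m (n : ℕ), h m * F ((n + 1 : ℝ) * h m) = h m * Real.exp (-(h m * x)) *
      (u ((n + 1 : ℝ) * h m) * Real.exp (-(h m * x)) ^ n) := fun m n => by
    have : Real.exp (-(x * ((n + 1 : ℝ) * h m))) =
        Real.exp (-(h m * x)) * Real.exp (-(h m * x)) ^ n := by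
      rw [← Real.exp_nat_mul, ← Real.exp_add]; congr 1; ring
    simp only [hF, this]; ring
  have hsum : ∀ m, Summable fun n : ℕ => h m * F ((n + 1 : ℝ) * h m) := fun m => by
    simp_rw [hterm]
    refine Summable.mul_left _ (summable_norm_mul_pow_of_abs_le (M := u (h m)) (fun n => ?_)
      (Real.exp_pos _).le (Real.exp_lt_one_iff.2 (neg_lt_zero.2 (mul_pos (hh m) hx)))).of_norm
    have hp : 0 < (n + 1 : ℝ) * h m := mul_pos (by positivity) (hh m)
    rw [abs_of_pos (hpos _ hp)]
    refine hanti (hh m) hp ?_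
    have := mul_nonneg n.cast_nonneg (hh m).le (α := ℝ)
    linarith
  have hb := fun m => hFanti.tsum_mul_le_integral_Ioi hFpos hi (hh m) (hsum m)
  have h1 : Tendsto (fun m => ∑' n : ℕ, h m * F ((n + 1 : ℝ) * h m)) atTop (𝓝 (φ x)) := by
    rw [(hL x hx).2]
    exact tendsto_of_tendsto_of_tendsto_of_le_of_le (tendsto_setIntegral_Ioi_zero hi hh hlim)
      tendsto_const_nhds (fun m => (hb m).1) (fun m => (hb m).2)
  have h2 : Tendsto (fun m => Real.exp (h m * x)) atTop (𝓝 1) := by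
    have := (Real.continuous_exp.tendsto _).comp (hlim.mul_const x)
    simpa [Function.comp_def] using this
  have h3 := h2.mul h1
  rw [one_mul] at h3
  refine h3.congr fun m => ?_
  simp_rw [hterm]
  rw [tsum_mul_left, ← mul_assoc, mul_left_comm, ← Real.exp_add]
  simp

lemma tendsto_one_sub_exp_div {h : ℕ → ℝ} (hh : ∀ m, 0 < h m) (hlim : Tendsto h atTop (𝓝 0))
    (x : ℝ) : Tendsto (fun m => (1 - Real.exp (-(h m * x))) / h m) atTop (𝓝 x) := by
  have hd : HasDerivAt (fun t : ℝ => -Real.exp (-(t * x))) x 0 := by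
    convert! (((hasDerivAt_id (0 : ℝ)).mul_const x).neg.exp).neg using 1
    simp
  have := hd.tendsto_slope.comp (tendsto_nhdsWithin_iff.2
    ⟨hlim, Eventually.of_forall fun m => (hh m).ne'⟩)
  refine this.congr fun m => ?_
  simp [slope_def_field]; ring

lemma IsLaplaceTransformOf.pos {φ u : ℝ → ℝ} (hpos : ∀ t, 0 < t → 0 < u t)
    (hL : IsLaplaceTransformOf φ u) {x : ℝ} (hx : 0 < x) : 0 < φ x := by
  rw [(hL x hx).2, setIntegral_pos_iff_support_of_nonneg_ae _ (hL x hx).1]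
  · have : Function.support (fun t => Real.exp (-(x * t)) * u t) ∩ Ioi 0 = Ioi 0 := by
      refine inter_eq_right.2 fun t ht => ?_
      exact (mul_pos (Real.exp_pos _) (hpos t ht)).ne'
    rw [this]; simp
  · filter_upwards [ae_restrict_mem measurableSet_Ioi] with t ht
    exact (mul_pos (Real.exp_pos _) (hpos t ht)).le

/-! ### Passage to the limit -/

/-- Sign patterns of the iterated differences of `x φ(x)`, `1 / φ(x)` and `1 / (x φ(x))` when `φ`
is the Laplace transform of a nonincreasing log-convex function. -/
lemma altMonotone_of_laplace {φ u : ℝ → ℝ} (hanti : AntitoneOn u (Ioi 0))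
    (hlc : LogConvexOnPos u) (hL : IsLaplaceTransformOf φ u) :
    AltMonotoneDiff (fun x => -(x * φ x)) ∧ AltMonotoneDiff (fun x => -(1 / φ x)) ∧
      AltMonotone (fun x => 1 / (x * φ x)) := by
  obtain ⟨h, hh, hlim⟩ : ∃ h : ℕ → ℝ, (∀ m, 0 < h m) ∧ Tendsto h atTop (𝓝 0) :=
    ⟨fun m => 1 / (m + 1 : ℝ), fun m => Nat.one_div_pos_of_nat,
      tendsto_one_div_add_atTop_nhds_zero_nat⟩
  have hcancel : ∀ m (y z : ℝ), y / h m * (h m * z) = y * z := fun m y z => by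
    rw [← mul_assoc, div_mul_cancel₀ _ (hh m).ne']
  have hS := fun x (hx : 0 < x) => tendsto_sampled_laplace hanti hlc.1 hL hh hlim hx
  have hq := tendsto_one_sub_exp_div hh hlim
  have hφ := fun x (hx : 0 < x) => hL.pos hlc.1 hx
  have hexp := fun m => exists_kaluza_expansions (hanti.logConvex_sample hlc (hh m)).1
    (hanti.logConvex_sample hlc (hh m)).2.1 (hanti.logConvex_sample hlc (hh m)).2.2
  choose c e d hc he hd hs using hexp
  have hs' := fun m x (hx : 0 < x) => hs m _ (Real.exp_pos (-(h m * x))).le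
    (Real.exp_lt_one_iff.2 (neg_lt_zero.2 (mul_pos (hh m) hx)))
  refine ⟨?_, ?_, ?_⟩
  · refine AltMonotoneDiff.of_tendsto (F := atTop)
      (fun x hx => ((hq x).mul (hS x hx)).neg) fun m => ?_
    refine AltMonotoneDiff.of_hasSum (hh m).le (b := fun n => -d m n)
      (fun n => neg_nonneg.2 (hd m n)) fun x hx => ?_
    have := (hs' m x hx).2.2.neg
    rw [hcancel]
    simpa using this
  · refine AltMonotoneDiff.of_tendsto (F := atTop)
      (fun x hx => (tendsto_const_nhds (x := (1 : ℝ)).div (hS x hx) (hφ x hx).ne').neg)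
      fun m => ?_
    simp only [Pi.div_apply]
    refine AltMonotoneDiff.of_hasSum (hh m).le (b := fun n => (h m)⁻¹ * -c m n)
      (fun n => mul_nonneg (inv_pos.2 (hh m)).le (neg_nonneg.2 (hc m n))) fun x hx => ?_
    have := ((hs' m x hx).1.neg).mul_left (h m)⁻¹
    convert! this using 1
    · ext n; ring
    · simp only [one_div, mul_inv, mul_neg]
  · refine AltMonotone.of_tendsto (F := atTop)
      (fun x hx => (tendsto_const_nhds (x := (1 : ℝ))).div ((hq x).mul (hS x hx))
        (mul_pos hx (hφ x hx)).ne') fun m => ?_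
    simp only [Pi.div_apply]
    refine AltMonotone.of_hasSum (hh m).le (he m) fun x hx => ?_
    have := (hs' m x hx).2.1
    rwa [hcancel]

theorem mainTheorem8 (α : ℝ) (hα : 0 ≤ α) (f : ℝ → ℝ) (hf : ClassC α f) :
    GenBernstein 1 (fun x => x ^ (α + 1) * f x) ∧
      GenBernstein (α + 1) (fun x => 1 / f x) ∧
      CompletelyMonotonic (fun x => 1 / (x ^ (α + 1) * f x)) := by
  obtain ⟨hfpos, u, hanti, hlc, hL⟩ := hf
  set φ : ℝ → ℝ := fun x => x ^ α * f x with hφdef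
  have hφs : ContDiffOn ℝ ∞ φ (Ioi 0) := contDiffOn_laplace (fun t ht => (hlc.1 t ht).le) hL
  have hφpos : ∀ x, 0 < x → 0 < φ x := fun x hx => hL.pos hlc.1 hx
  obtain ⟨h1, h2, h3⟩ := altMonotone_of_laplace hanti hlc hL
  have hderiv : ∀ {g : ℝ → ℝ}, ContDiffOn ℝ ∞ g (Ioi 0) → ∀ x, 0 < x →
      HasDerivAt g (deriv g x) x := fun hg x hx =>
    ((hg.differentiableOn (by simp)).differentiableAt (Ioi_mem_nhds hx)).hasDerivAt
  have hds : ∀ {g : ℝ → ℝ}, ContDiffOn ℝ ∞ g (Ioi 0) → ContDiffOn ℝ ∞ (deriv g) (Ioi 0) :=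
    fun hg => hg.deriv_of_isOpen isOpen_Ioi (by simp)
  have hrpow : ∀ p : ℝ, ContDiffOn ℝ ∞ (fun x : ℝ => x ^ p) (Ioi 0) := fun p x hx =>
    (Real.contDiffAt_rpow_const_of_ne (ne_of_gt hx)).contDiffWithinAt
  have hpow : EqOn (fun x => x ^ (α + 1) * f x) (fun x => x * φ x) (Ioi 0) := fun x hx => by
    simp only [hφdef, Real.rpow_add hx, Real.rpow_one]; ring
  have hxφs : ContDiffOn ℝ ∞ (fun x => x ^ (α + 1) * f x) (Ioi 0) :=
    (contDiffOn_id.mul hφs).congr hpow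
  have hxfpos : ∀ x : ℝ, 0 < x → 0 < x ^ (α + 1) * f x := fun x hx =>
    mul_pos (Real.rpow_pos_of_pos hx _) (hfpos x hx)
  have hψs : ContDiffOn ℝ ∞ (fun x => 1 / φ x) (Ioi 0) :=
    contDiffOn_const.div hφs fun x hx => (hφpos x hx).ne'
  have hrec : EqOn (fun x => 1 / f x) (fun x => x ^ α * (1 / φ x)) (Ioi 0) := fun x hx => by
    have := (Real.rpow_pos_of_pos hx α).ne'
    have := (hfpos x hx).ne'
    simp only [hφdef]; field_simp
  have hrecs : ContDiffOn ℝ ∞ (fun x => 1 / f x) (Ioi 0) := ((hrpow α).mul hψs).congr hrec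
  have hA3 : AltMonotone (fun x => 1 / (x ^ (α + 1) * f x)) :=
    h3.congr fun x hx => by simp only [hpow hx]
  refine ⟨⟨hxφs, hxfpos, ?_⟩, ⟨hrecs, fun x hx => one_div_pos.2 (hfpos x hx), ?_⟩,
    hA3.completelyMonotonic (contDiffOn_const.div hxφs fun x hx => (hxfpos x hx).ne')⟩
  · refine AltMonotone.completelyMonotonic ?_ ((hrpow _).mul (hds hxφs))
    have h1' : AltMonotoneDiff (fun x => -(x ^ (α + 1) * f x)) :=
      h1.congr fun x hx => congrArg Neg.neg (hpow hx)
    refine (h1'.neg_deriv fun x hx => (hderiv hxφs x hx).neg).congr fun x _ => ?_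
    simp
  · refine AltMonotone.completelyMonotonic ?_ ((hrpow _).mul (hds hrecs))
    have hA2 : AltMonotone (fun x => - -deriv (fun x => 1 / φ x) x) :=
      h2.neg_deriv fun x hx => (hderiv hψs x hx).neg
    -- Here x^{-α}(1/f)' = α · 1/(xφ) + (1/φ)', and both summands have nonnegative differences.
    refine (AltMonotone.const_mul_add hα hA3 hA2).congr fun x hx => ?_
    have hd : deriv (fun x => 1 / f x) x =
        α * x ^ (α - 1) * (1 / φ x) + x ^ α * deriv (fun x => 1 / φ x) x := by
      have := (Real.hasDerivAt_rpow_const (p := α) (Or.inl (ne_of_gt hx))).mul (hderiv hψs x hx)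
      exact (this.congr_of_eventuallyEq
        (hrec.eventuallyEq_of_mem (Ioi_mem_nhds hx))).deriv
    have hxa := (Real.rpow_pos_of_pos hx α).ne'
    have hfx := (hfpos x hx).ne'
    have hx0 : x ≠ 0 := ne_of_gt hx
    have e1 : x ^ (1 - (α + 1)) = (x ^ α)⁻¹ := by
      rw [← Real.rpow_neg (le_of_lt hx)]; congr 1; ring
    simp only [hd, e1, neg_neg, Real.rpow_sub hx, Real.rpow_add hx, Real.rpow_one]
    rw [mul_add, ← mul_assoc (x ^ α)⁻¹ (x ^ α), inv_mul_cancel₀ hxa, one_mul]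
    congr 1
    simp only [hφdef]
    field_simp
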